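/- **Setting.** Let $\mathfrak g=\mathfrak g_0\oplus\mathfrak g_1$ be a finite-dimensional simple Lie superalgebra over $\mathbb C$ of rank $r$, with a chosen Dynkin diagram: nodes $I=\{1,\dots,r\}=I_w\sqcup I_g\sqcup I_b$ (white, grey, black, i.e. even, odd isotropic and odd non-isotropic simple roots $\alpha_i$), Chevalley generators $e_i,f_i,\check\alpha_i$, Cartan matrix $a_{ji}=\langle\check\alpha_j,\alpha_i\rangle$ with $a_{ii}=2$ for $i\in I_w\cup I_b$ and $a_{ii}=0$ for $i\in I_g$, the $\check\alpha_i$ forming a basis of the Cartan subalgebra $\mathfrak h$. Put $\check\alpha_i'=\check\alpha_i$ for $i\in I_w\cup I_g$ and $\check\alpha_i'=\frac12\check\alpha_i$ for $i\in I_b$. Let $\bar{\mathfrak g}=\mathfrak g_0$, and let $\bar{\mathfrak n}_+$ be the even part of the subsuperalgebra generated by the $e_i$. Let $\omega_i\in\mathfrak h^*$ be the fundamental weights, $\langle\omega_i,\check\alpha_j\rangle=\delta_{ij}$, and let $V_i$ be the irreducible highest weight $\bar{\mathfrak g}$-module of highest weight $\lambda_i=\omega_i$ if $i\in I_w\cup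 I_g$ and $\lambda_i=2\omega_i$ if $i\in I_b$ (not necessarily finite-dimensional). Let $W_i\subset V_i$ be spanned by the vectors of weights $\omega_i,\ \omega_i-\alpha_i$ if $i\in I_w$; $2\omega_i,\ 2\omega_i-2\alpha_i$ if $i\in I_b$; $\omega_i$ if $i\in I_g$. Let $H$ be an algebraic torus with Lie algebra $\mathfrak h$ such that all simple roots and all $\lambda_i$ are characters of $H$ (for instance the torus with cocharacter lattice $\bigoplus_i\mathbb Z\check\alpha_i'$, when the roots are integral on it). Let $\bar B_+(z)=H(z)\bar N_+(z)$ be the group of $\mathbb C(z)$-points of the Borel group with torus $H$ and unipotent radical $\bar N_+=\exp\bar{\mathfrak n}_+$; it acts on each $V_i(z)=\mathbb C(z)\otimes V_i$. Let $H\subset H(z)$ also denote the subgroup of constant elements, and let $\tilde N_+(z)\subset\bar N_+(z)$ be the subgroup generated by all $\exp(a(z)[e_i,e_j])$, where $a(z)\in\mathbb C(z)$, $i\neq j$, and $[e_i,e_j]$ is even (that is, $e_i$ and $e_j$ have the same parity). Let $$\nabla=\partial_z+\sum_{i\in I}u^i(z)\check\alpha_i'+\sum_{i\in I_w}L_i(z)e_i+\frac12\sum_{i,j\in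 I_b\cup I_g}L_i(z)L_j(z)[e_i,e_j]$$ be a Miura $\bar G$-oper connection, with $u^i(z)$ rational and $L_i(z)$ nonzero rational functions, and let $Z\in\mathfrak h$. We say that $v(z)\in\bar B_+(z)$ satisfies the $Z$-twisted Miura–Plücker condition for $\nabla$ if for every $i\in I$ $$\nabla|_{W_i}=v(z)(\partial_z+Z)v(z)^{-1}|_{W_i}=v_i(z)(\partial_z+Z_i)v_i(z)^{-1},\qquad v_i(z)=v(z)|_{W_i},\quad Z_i=Z|_{W_i},$$ as operators on $W_i(z)=\mathbb C(z)\otimes W_i$ with values in $V_i(z)$. **Proposition.** If $v(z)\in\bar B_+(z)$ satisfies the $Z$-twisted Miura–Plücker condition for $\nabla$, then so does every element of the coset $v(z)\,H\,\tilde N_+(z)$. -/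

import Mathlib

open scoped TensorProduct

/-! ### The differential field `ℂ(z)` -/

/-- The field `ℂ(z)` of rational functions in one variable over `ℂ`. -/
abbrev RF : Type := RatFunc ℂ

namespace RF

/-- The derivative of a rational function, by the quotient rule on numerator and denominator. -/
noncomputable def deriv (f : RF) : RF :=
  (algebraMap (Polynomial ℂ) RF (Polynomial.derivative f.num) *
      algebraMap (Polynomial ℂ) RF f.denom -
    algebraMap (Polynomial ℂ) RF f.num *
      algebraMap (Polynomial ℂ) RF (Polynomial.derivative f.denom)) /
    algebraMap (Polynomial ℂ) RF f.denom ^ 2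

/-- The quotient rule holds for every presentation of a rational function as a fraction. -/
theorem deriv_div (p q : Polynomial ℂ) (hq : q ≠ 0) :
    deriv (algebraMap (Polynomial ℂ) RF p / algebraMap (Polynomial ℂ) RF q) =
      (algebraMap (Polynomial ℂ) RF (Polynomial.derivative p) * algebraMap (Polynomial ℂ) RF q -
        algebraMap (Polynomial ℂ) RF p * algebraMap (Polynomial ℂ) RF (Polynomial.derivative q)) /
        algebraMap (Polynomial ℂ) RF q ^ 2 := by
  set f : RF := algebraMap (Polynomial ℂ) RF p / algebraMap (Polynomial ℂ) RF q with hf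
  have hd : f.denom ≠ 0 := f.denom_ne_zero
  have hq' : algebraMap (Polynomial ℂ) RF q ≠ 0 := RatFunc.algebraMap_ne_zero hq
  have hd' : algebraMap (Polynomial ℂ) RF f.denom ≠ 0 := RatFunc.algebraMap_ne_zero hd
  have h1 : f.num * q = p * f.denom := by
    apply RatFunc.algebraMap_injective ℂ
    have h := RatFunc.num_div_denom f
    nth_rewrite 3 [hf] at h
    rw [div_eq_div_iff hd' hq'] at h
    simpa using h
  have h2 := congrArg Polynomial.derivative h1
  rw [Polynomial.derivative_mul, Polynomial.derivative_mul] at h2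
  have h1' := congrArg (algebraMap (Polynomial ℂ) RF) h1
  have h2' := congrArg (algebraMap (Polynomial ℂ) RF) h2
  simp only [map_mul, map_add] at h1' h2'
  unfold deriv
  rw [div_eq_div_iff (pow_ne_zero 2 hd') (pow_ne_zero 2 hq')]
  linear_combination
    (algebraMap (Polynomial ℂ) RF q * algebraMap (Polynomial ℂ) RF f.denom) * h2'
      - (algebraMap (Polynomial ℂ) RF (Polynomial.derivative q) *
          algebraMap (Polynomial ℂ) RF f.denom
        + algebraMap (Polynomial ℂ) RF q *
          algebraMap (Polynomial ℂ) RF (Polynomial.derivative f.denom)) * h1'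

theorem deriv_add (f g : RF) : deriv (f + g) = deriv f + deriv g := by
  have hf := RatFunc.algebraMap_ne_zero (K := ℂ) f.denom_ne_zero
  have hg := RatFunc.algebraMap_ne_zero (K := ℂ) g.denom_ne_zero
  have h : f + g = algebraMap (Polynomial ℂ) RF (f.num * g.denom + g.num * f.denom) /
      algebraMap (Polynomial ℂ) RF (f.denom * g.denom) := by
    conv_lhs => rw [← RatFunc.num_div_denom f, ← RatFunc.num_div_denom g]
    simp only [map_mul, map_add]
    field_simp
  rw [h, deriv_div _ _ (mul_ne_zero f.denom_ne_zero g.denom_ne_zero)]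
  simp only [deriv, Polynomial.derivative_mul, map_mul, map_add]
  field_simp
  ring

theorem deriv_mul (f g : RF) : deriv (f * g) = f * deriv g + g * deriv f := by
  have hf := RatFunc.algebraMap_ne_zero (K := ℂ) f.denom_ne_zero
  have hg := RatFunc.algebraMap_ne_zero (K := ℂ) g.denom_ne_zero
  have h : f * g = algebraMap (Polynomial ℂ) RF (f.num * g.num) /
      algebraMap (Polynomial ℂ) RF (f.denom * g.denom) := by
    conv_lhs => rw [← RatFunc.num_div_denom f, ← RatFunc.num_div_denom g]
    simp only [map_mul]
    field_simp
  rw [h, deriv_div _ _ (mul_ne_zero f.denom_ne_zero g.denom_ne_zero)]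
  have e : f * deriv g + g * deriv f =
      (algebraMap (Polynomial ℂ) RF f.num / algebraMap (Polynomial ℂ) RF f.denom) * deriv g +
      (algebraMap (Polynomial ℂ) RF g.num / algebraMap (Polynomial ℂ) RF g.denom) * deriv f := by
    rw [RatFunc.num_div_denom, RatFunc.num_div_denom]
  rw [e]
  simp only [deriv, Polynomial.derivative_mul, map_mul, map_add]
  field_simp
  ring

theorem deriv_algebraMap (p : Polynomial ℂ) :
    deriv (algebraMap (Polynomial ℂ) RF p) =
      algebraMap (Polynomial ℂ) RF (Polynomial.derivative p) := by
  have := deriv_div p 1 one_ne_zero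
  simpa using this

theorem deriv_const (c : ℂ) : deriv (algebraMap ℂ RF c) = 0 := by
  have h : algebraMap ℂ RF c = algebraMap (Polynomial ℂ) RF (Polynomial.C c) := by
    rw [IsScalarTower.algebraMap_apply ℂ (Polynomial ℂ) RF]; rfl
  rw [h, deriv_algebraMap]
  simp

/-- The derivation `∂_z` of `ℂ(z)`. -/
noncomputable def dz : Derivation ℂ RF RF :=
  Derivation.mk'
    { toFun := deriv
      map_add' := deriv_add
      map_smul' := fun c f => by
        rw [Algebra.smul_def, deriv_mul, deriv_const, RingHom.id_apply, Algebra.smul_def]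
        simp }
    (fun f g => by simp [deriv_mul])

end RF

/-! ### Lie superalgebras -/

/-- A complex Lie superalgebra `𝔤 = 𝔤₀ ⊕ 𝔤₁`: a Lie algebra `𝔤₀`, a `𝔤₀`-module `𝔤₁`, and a
symmetric `𝔤₀`-equivariant bracket `𝔤₁ × 𝔤₁ → 𝔤₀` satisfying the odd Jacobi identity. -/
structure LieSuperalgebra (g₀ g₁ : Type*) [LieRing g₀] [LieAlgebra ℂ g₀] [AddCommGroup g₁]
    [Module ℂ g₁] [LieRingModule g₀ g₁] [LieModule ℂ g₀ g₁] where
  oddBracket : g₁ →ₗ[ℂ] g₁ →ₗ[ℂ] g₀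
  symm : ∀ x y, oddBracket x y = oddBracket y x
  equivariant : ∀ (a : g₀) (x y : g₁),
    ⁅a, oddBracket x y⁆ = oddBracket ⁅a, x⁆ y + oddBracket x ⁅a, y⁆
  jacobi : ∀ x y z : g₁,
    ⁅oddBracket x y, z⁆ + ⁅oddBracket y z, x⁆ + ⁅oddBracket z x, y⁆ = 0

namespace LieSuperalgebra

variable {g₀ g₁ : Type*} [LieRing g₀] [LieAlgebra ℂ g₀] [AddCommGroup g₁]
  [Module ℂ g₁] [LieRingModule g₀ g₁] [LieModule ℂ g₀ g₁] (S : LieSuperalgebra g₀ g₁)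

/-- The superbracket on `𝔤 = 𝔤₀ × 𝔤₁` (even component first). -/
def bracket (x y : g₀ × g₁) : g₀ × g₁ :=
  (⁅x.1, y.1⁆ + S.oddBracket x.2 y.2, ⁅x.1, y.2⁆ - ⁅y.1, x.2⁆)

/-- The Lie subsuperalgebra generated by a set (of homogeneous elements). -/
def generated (s : Set (g₀ × g₁)) : Submodule ℂ (g₀ × g₁) :=
  sInf {T | s ⊆ T ∧ ∀ x ∈ T, ∀ y ∈ T, S.bracket x y ∈ T}

/-- Simplicity: the superbracket is not zero and the only graded ideals are `0` and `𝔤`. -/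
structure IsSimple : Prop where
  non_abelian : ∃ x y, S.bracket x y ≠ 0
  ideal_trivial : ∀ (I₀ : Submodule ℂ g₀) (I₁ : Submodule ℂ g₁),
    (∀ x, ∀ y ∈ I₀.prod I₁, S.bracket x y ∈ I₀.prod I₁) →
      I₀.prod I₁ = ⊥ ∨ I₀.prod I₁ = ⊤

/-- The colours of the nodes of a Dynkin diagram: `white` for even simple roots, `grey` for
odd isotropic ones, `black` for odd non-isotropic ones. -/
inductive NodeColour
  | white
  | grey
  | black
deriving DecidableEq

/-- A choice of Dynkin diagram with `r` nodes for `𝔤`, where `r` is the rank of `𝔤`, together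
with its Chevalley generators `e i`, `f i`, `coroot i` and its Cartan matrix
`a j i = ⟨coroot j, α_i⟩`. -/
structure ChevalleySystem (r : ℕ) where
  colour : Fin r → NodeColour
  a : Matrix (Fin r) (Fin r) ℂ
  e : Fin r → g₀ × g₁
  f : Fin r → g₀ × g₁
  coroot : Fin r → g₀
  e_even : ∀ i, colour i = .white → (e i).2 = 0
  f_even : ∀ i, colour i = .white → (f i).2 = 0
  e_odd : ∀ i, colour i ≠ .white → (e i).1 = 0
  f_odd : ∀ i, colour i ≠ .white → (f i).1 = 0
  a_white : ∀ i, colour i = .white → a i i = 2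
  a_grey : ∀ i, colour i = .grey → a i i = 0
  a_black : ∀ i, colour i = .black → a i i = 2
  coroot_comm : ∀ i j, ⁅coroot i, coroot j⁆ = 0
  coroot_e : ∀ i j, S.bracket (coroot j, 0) (e i) = a j i • e i
  coroot_f : ∀ i j, S.bracket (coroot j, 0) (f i) = -(a j i) • f i
  e_f : ∀ i j, S.bracket (e i) (f j) = if i = j then (coroot i, 0) else 0
  generates : S.generated (Set.range e ∪ Set.range f) = ⊤
  /-- The simple coroots form a basis of the Cartan subalgebra they span. -/
  coroot_indep : LinearIndependent ℂ coroot

namespace ChevalleySystem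

variable {S} {r : ℕ} (D : S.ChevalleySystem r)

/-- The Cartan subalgebra `𝔥`. -/
def cartan : Submodule ℂ g₀ := Submodule.span ℂ (Set.range D.coroot)

/-- `coroot i` for white and grey nodes, `coroot i / 2` for black nodes. -/
noncomputable def coroot' (i : Fin r) : g₀ :=
  if D.colour i = .black then (1 / 2 : ℂ) • D.coroot i else D.coroot i

/-- `n̄₊`, the even part of the subsuperalgebra `𝔫₊` generated by the `e i`. -/
def nPlus : Submodule ℂ g₀ :=
  (S.generated (Set.range D.e)).comap (LinearMap.inl ℂ g₀ g₁)

/-- The even component of `[e_i, e_j]`; it is all of `[e_i, e_j]` when `e_i` and `e_j` have the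
same parity. -/
def eBracket (i j : Fin r) : g₀ := (S.bracket (D.e i) (D.e j)).1

/-- The simple root `α_i`. A weight `μ ∈ 𝔥^*` is given by its values `μ j` on `coroot j`. -/
def simpleRoot (i : Fin r) : Fin r → ℂ := fun j => D.a j i

/-- The fundamental weight `ω_i`: `⟨ω_i, coroot j⟩ = δ_ij`. -/
def fundWeight (_ : S.ChevalleySystem r) (i : Fin r) : Fin r → ℂ := Pi.single i 1

/-- The highest weight of the `i`-th module: `2 ω_i` for black nodes, `ω_i` for the others. -/
noncomputable def highestWeight (i : Fin r) : Fin r → ℂ :=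
  if D.colour i = .black then (2 : ℂ) • D.fundWeight i else D.fundWeight i

section Modules

variable (V : Type*) [AddCommGroup V] [Module ℂ V] [LieRingModule g₀ V] [LieModule ℂ g₀ V]

/-- The weight space of weight `μ` in a `ḡ`-module. -/
def weightSpace (μ : Fin r → ℂ) : Submodule ℂ V where
  carrier := {v | ∀ j, ⁅D.coroot j, v⁆ = μ j • v}
  zero_mem' := fun j => by simp
  add_mem' := fun {v w} hv hw j => by rw [lie_add, hv j, hw j, smul_add]
  smul_mem' := fun c v hv j => by rw [lie_smul, hv j, smul_comm]

/-- `V` is an irreducible highest weight module of `ḡ = 𝔤₀` of highest weight `μ`, with respect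
to the Borel subalgebra `𝔥 ⊕ n̄₊`; no dominance of `μ` is required. -/
def IsIrreducibleHighestWeight (μ : Fin r → ℂ) : Prop :=
  LieModule.IsIrreducible ℂ g₀ V ∧
    ∃ v : V, v ≠ 0 ∧ v ∈ D.weightSpace V μ ∧ ∀ x ∈ D.nPlus, ⁅x, v⁆ = 0

/-- The subspace `W_i` of the `i`-th module, spanned by the vectors of weight
* `ω_i` and `ω_i - α_i` if `i` is white;
* `2 ω_i` and `2 ω_i - 2 α_i` if `i` is black;
* `ω_i` if `i` is grey. -/
noncomputable def W (i : Fin r) : Submodule ℂ V :=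
  match D.colour i with
  | .white => D.weightSpace V (D.highestWeight i) ⊔
      D.weightSpace V (D.highestWeight i - D.simpleRoot i)
  | .black => D.weightSpace V (D.highestWeight i) ⊔
      D.weightSpace V (D.highestWeight i - (2 : ℂ) • D.simpleRoot i)
  | .grey => D.weightSpace V (D.highestWeight i)

/-- The connection `∂_z + A` on the trivial bundle with fibre `V`. -/
noncomputable def connection (A : RF ⊗[ℂ] g₀) : RF ⊗[ℂ] V →ₗ[ℂ] RF ⊗[ℂ] V :=
  RF.dz.toLinearMap.rTensor V +
    (LieModule.toEnd RF (RF ⊗[ℂ] g₀) (RF ⊗[ℂ] V) A).restrictScalars ℂ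

end Modules

/-! ### The groups `H`, `B̄₊(z)`, `Ñ₊(z)` -/

/-- The algebraic torus `H` with Lie algebra `𝔥`, through a basis `cochar` of its cocharacter
lattice. The weights of the highest weight modules are characters of `H`, that is, cocharacters
are integral combinations of the `coroot' k`, and so are the roots. The largest
choice of lattice, `coeff = 1`, is the one spanned by all `coroot' k`. -/
structure Torus where
  coeff : Matrix (Fin r) (Fin r) ℤ
  coeff_det : coeff.det ≠ 0
  root_integral : ∀ i j, ∃ n : ℤ,
    S.bracket (∑ k, (coeff j k : ℂ) • D.coroot' k, 0) (D.e i) = (n : ℂ) • D.e i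

namespace Torus

variable {D} (T : D.Torus)

/-- The differential of the `j`-th basic cocharacter of `H`, an element of `𝔥`. -/
noncomputable def cochar (j : Fin r) : g₀ := ∑ k, (T.coeff j k : ℂ) • D.coroot' k

/-- `E` is the action on `V(z)` of the point `t` of `H(z) = (ℂ(z)ˣ)^r`: on a vector on which the
`j`-th basic cocharacter has weight `n j` for all `j`, it is the scalar `∏ j, t j ^ n j`. -/
def IsAction {V : Type*} [AddCommGroup V] [Module ℂ V] [LieRingModule g₀ V] [LieModule ℂ g₀ V]
    (t : Fin r → RFˣ) (E : (RF ⊗[ℂ] V) ≃ₗ[RF] (RF ⊗[ℂ] V)) : Prop :=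
  ∀ (n : Fin r → ℤ) (v : V), (∀ j, ⁅T.cochar j, v⁆ = (n j : ℂ) • v) →
    E (1 ⊗ₜ[ℂ] v) = ((∏ j, t j ^ n j : RFˣ) : RF) ⊗ₜ[ℂ] v

end Torus

/-- `E` is the exponential of the locally nilpotent operator `X`. -/
def IsExp {M : Type*} [AddCommGroup M] [Module RF M] (X : Module.End RF M) (E : M ≃ₗ[RF] M) :
    Prop :=
  ∀ w : M, ∃ N : ℕ, (X ^ N) w = 0 ∧
    E w = ∑ n ∈ Finset.range N, ((n.factorial : RF)⁻¹) • (X ^ n) w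

/-- The ambient group `H(z) × GL(ḡ(z)) × ∏ i, GL(V_i(z))`. The group `B̄₊(z) = H(z) N̄₊(z)` is
realized in it faithfully: an element is recorded through its torus part, its adjoint action
and its action on the modules `V_i`. -/
abbrev Ambient (g₀ : Type*) [LieRing g₀] [LieAlgebra ℂ g₀] {r : ℕ} (V : Fin r → Type*)
    [∀ i, AddCommGroup (V i)] [∀ i, Module ℂ (V i)] : Type _ :=
  (Fin r → RFˣ) × ((RF ⊗[ℂ] g₀) ≃ₗ[RF] (RF ⊗[ℂ] g₀)) ×
    (∀ i, (RF ⊗[ℂ] V i) ≃ₗ[RF] (RF ⊗[ℂ] V i))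

section Groups

variable (V : Fin r → Type*) [∀ i, AddCommGroup (V i)] [∀ i, Module ℂ (V i)]
  [∀ i, LieRingModule g₀ (V i)] [∀ i, LieModule ℂ g₀ (V i)]

/-- `b` is the element `t` of `H(z)`. -/
def IsTorusElement {D : S.ChevalleySystem r} (T : D.Torus) (t : Fin r → RFˣ)
    (b : Ambient g₀ V) : Prop :=
  b.1 = t ∧ T.IsAction t b.2.1 ∧ ∀ i, T.IsAction t (b.2.2 i)

/-- `b` is the unipotent element `exp x`, for `x ∈ ḡ(z)`. -/
def IsUnipotentElement (x : RF ⊗[ℂ] g₀) (b : Ambient g₀ V) : Prop :=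
  b.1 = 1 ∧ IsExp (LieModule.toEnd RF (RF ⊗[ℂ] g₀) (RF ⊗[ℂ] g₀) x) b.2.1 ∧
    ∀ i, IsExp (LieModule.toEnd RF (RF ⊗[ℂ] g₀) (RF ⊗[ℂ] V i) x) (b.2.2 i)

/-- `B̄₊(z)`, generated by `H(z)` and by the `exp x` for `x ∈ n̄₊(z)`. -/
noncomputable def borel (T : D.Torus) : Subgroup (Ambient g₀ V) :=
  Subgroup.closure ({b | ∃ t, IsTorusElement V T t b} ∪
    {b | ∃ x ∈ D.nPlus.baseChange RF, IsUnipotentElement V x b})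

/-- The group `H` of constant elements of `H(z)`. -/
noncomputable def constTorus (T : D.Torus) : Subgroup (Ambient g₀ V) :=
  Subgroup.closure {b | ∃ t : Fin r → ℂˣ,
    IsTorusElement V T (fun j => Units.map (algebraMap ℂ RF : ℂ →* RF) (t j)) b}

/-- `Ñ₊(z)`, generated by the one-parameter subgroups `exp (a(z) [e_i, e_j])`, `a(z) ∈ ℂ(z)`, of
the even commutators `[e_i, e_j]` with `i ≠ j`. -/
noncomputable def nTilde : Subgroup (Ambient g₀ V) :=
  Subgroup.closure {b | ∃ i j, i ≠ j ∧ (D.colour i = .white ↔ D.colour j = .white) ∧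
    ∃ a : RF, IsUnipotentElement V (a ⊗ₜ[ℂ] D.eBracket i j) b}

/-- The coset `v(z) H Ñ₊(z)`. -/
def framingCoset (T : D.Torus) (v : Ambient g₀ V) : Set (Ambient g₀ V) :=
  {g | ∃ h ∈ D.constTorus V T, ∃ n ∈ D.nTilde V, g = v * h * n}

end Groups

/-! ### Miura opers and the Miura-Plücker condition -/

/-- The coefficients of a Miura `Ḡ`-oper connection
`∂_z + ∑ u^i α̌'_i + ∑_{i white} L_i e_i + 1/2 ∑_{i, j grey or black} L_i L_j [e_i, e_j]`, with
`u^i` rational and `L_i` nonzero rational functions. -/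
structure MiuraOper (r : ℕ) where
  u : Fin r → RF
  L : Fin r → RF
  L_ne_zero : ∀ i, L i ≠ 0

/-- The connection form of a Miura `Ḡ`-oper, an element of `ḡ(z)`. -/
noncomputable def miuraForm (O : MiuraOper r) : RF ⊗[ℂ] g₀ :=
  (∑ i, O.u i ⊗ₜ[ℂ] D.coroot' i) +
  (∑ i with D.colour i = .white, O.L i ⊗ₜ[ℂ] (D.e i).1) +
  (1 / 2 : RF) • ∑ i with D.colour i ≠ .white, ∑ j with D.colour j ≠ .white,
    (O.L i * O.L j) ⊗ₜ[ℂ] D.eBracket i j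

variable (V : Fin r → Type*) [∀ i, AddCommGroup (V i)] [∀ i, Module ℂ (V i)]
  [∀ i, LieRingModule g₀ (V i)] [∀ i, LieModule ℂ g₀ (V i)]

/-- The inclusion `W_i(z) → V_i(z)`. -/
noncomputable def inclW (i : Fin r) : RF ⊗[ℂ] (D.W (V i) i) →ₗ[RF] RF ⊗[ℂ] V i :=
  (D.W (V i) i).subtype.baseChange RF

/-- The `Z`-twisted Miura-Plücker condition on `v(z) ∈ B̄₊(z)`: for every `i`,
`∇_i = v(z) (∂_z + Z) v(z)⁻¹ |_{W_i} = v_i(z) (∂_z + Z_i) v_i(z)⁻¹`,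
where `v_i(z)` and `Z_i` are the restrictions of `v(z)` and `Z` to `W_i`. -/
def MiuraPluckerCondition (T : D.Torus) (O : MiuraOper r) (Z : g₀) (v : Ambient g₀ V) : Prop :=
  v ∈ D.borel V T ∧
  ∀ i, ∃ (vi : (RF ⊗[ℂ] (D.W (V i) i)) ≃ₗ[RF] (RF ⊗[ℂ] (D.W (V i) i)))
      (Zi : Module.End ℂ (D.W (V i) i)),
    (∀ w, D.inclW V i (vi w) = v.2.2 i (D.inclW V i w)) ∧
    (∀ w, ((Zi w : D.W (V i) i) : V i) = ⁅Z, (w : V i)⁆) ∧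
    ∀ w : RF ⊗[ℂ] (D.W (V i) i),
      connection (V i) (D.miuraForm O) (D.inclW V i w) =
        v.2.2 i (connection (V i) (1 ⊗ₜ[ℂ] Z) ((v.2.2 i).symm (D.inclW V i w))) ∧
      v.2.2 i (connection (V i) (1 ⊗ₜ[ℂ] Z) ((v.2.2 i).symm (D.inclW V i w))) =
        D.inclW V i (vi ((RF.dz.toLinearMap.rTensor (D.W (V i) i) +
          Zi.lTensor RF) (vi.symm w)))

end ChevalleySystem

end LieSuperalgebra

/-! Write an element of the coset as `v b` with `b = h n`. Since `v` and `Z` preserve `W_i(z)`, the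
condition passes from `v` to `v b` as soon as `b` maps each `W_i(z)` onto itself and commutes there
with `∂_z + Z`; nothing is needed on the rest of `V_i(z)` (`MiuraPluckerCondition.mul`).

For `h` this holds because a constant torus element acts on each weight space in `W_i` by a
constant, which commutes with both `∂_z` and `Z ∈ 𝔥`.

For `n` more is true: it fixes `W_i(z)` pointwise, because `[e_p, e_q]` with `p ≠ q` kills `W_i`
(`lie_eBracket_eq_zero`). One of `p`, `q`, say `k`, differs from `i`. Grade by the fundamental
coweight dual to `α_k`. The weights of `W_i` differ from the highest weight by multiples of `α_i`,
so `W_i` lies in the top degree, while `[e_p, e_q]` raises the degree by one. The coweight exists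
because the Cartan matrix is invertible: a null vector would give a central element of the simple
`𝔤`. The degrees of `V_i` are bounded above because `V_i` is generated by its highest weight vector
under `n̄₋`, by the triangular decomposition. -/

set_option linter.unusedSectionVars false

namespace LieSuperalgebra

variable {g₀ g₁ : Type*} [LieRing g₀] [LieAlgebra ℂ g₀] [AddCommGroup g₁]
  [Module ℂ g₁] [LieRingModule g₀ g₁] [LieModule ℂ g₀ g₁] (S : LieSuperalgebra g₀ g₁)

/-! ### The superbracket as a bilinear map -/

/-- The superbracket as a bilinear map. -/
def ad : (g₀ × g₁) →ₗ[ℂ] (g₀ × g₁) →ₗ[ℂ] (g₀ × g₁) :=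
  LinearMap.mk₂ ℂ S.bracket
    (fun x x' y => by
      ext <;> simp only [bracket, Prod.fst_add, Prod.snd_add, add_lie, lie_add, map_add,
        LinearMap.add_apply] <;> abel)
    (fun c x y => by
      ext <;> simp only [bracket, Prod.smul_fst, Prod.smul_snd, smul_lie, lie_smul, map_smul,
        LinearMap.smul_apply, smul_add, smul_sub])
    (fun x y y' => by
      ext <;> simp only [bracket, Prod.fst_add, Prod.snd_add, add_lie, lie_add, map_add] <;> abel)
    (fun c x y => by
      ext <;> simp only [bracket, Prod.smul_fst, Prod.smul_snd, smul_lie, lie_smul, map_smul,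
        smul_add, smul_sub])

theorem ad_apply (x y : g₀ × g₁) : S.ad x y = S.bracket x y := rfl

/-- The parity involution. -/
def parity : (g₀ × g₁) →ₗ[ℂ] (g₀ × g₁) :=
  LinearMap.prodMap LinearMap.id (-LinearMap.id)

@[simp] theorem parity_apply (x : g₀ × g₁) : parity x = (x.1, -x.2) := rfl

theorem parity_parity (x : g₀ × g₁) : parity (parity x) = x := by simp

theorem parity_ad (x y : g₀ × g₁) : parity (S.ad x y) = S.ad (parity x) (parity y) := by
  ext
  · simp [ad_apply, bracket]
  · simp [ad_apply, bracket]
    abel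

theorem ad_even_swap (x : g₀) (y : g₀ × g₁) : S.ad y (x, 0) = -S.ad (x, 0) y := by
  ext <;> simp [ad_apply, bracket]

theorem ad_odd_swap (x : g₁) (y : g₀ × g₁) : S.ad y (0, x) = parity (S.ad (0, x) y) := by
  ext <;> simp [ad_apply, bracket, S.symm x]

theorem ad_even_ad (x : g₀) (y z : g₀ × g₁) :
    S.ad (x, 0) (S.ad y z) = S.ad (S.ad (x, 0) y) z + S.ad y (S.ad (x, 0) z) := by
  obtain ⟨y₀, y₁⟩ := y
  obtain ⟨z₀, z₁⟩ := z
  ext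
  · simp only [ad_apply, bracket, lie_add, S.equivariant, leibniz_lie x y₀ z₀]
    simp
    abel
  · simp only [ad_apply, bracket, lie_sub, leibniz_lie x y₀ z₁, leibniz_lie x z₀ y₁]
    simp
    abel

/-- Super Jacobi identity for odd `x`; `parity y` carries the sign for both components of `y` at
once. -/
theorem ad_odd_ad (x : g₁) (y z : g₀ × g₁) :
    S.ad (0, x) (S.ad y z) = S.ad (S.ad (0, x) y) z + S.ad (parity y) (S.ad (0, x) z) := by
  obtain ⟨y₀, y₁⟩ := y
  obtain ⟨z₀, z₁⟩ := z
  ext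
  · have h1 := S.equivariant y₀ x z₁
    have h2 : ⁅S.oddBracket x y₁, z₀⁆ = -(S.oddBracket y₁ ⁅z₀, x⁆ + S.oddBracket x ⁅z₀, y₁⁆) := by
      rw [← lie_skew, S.equivariant, S.symm y₁]
    simp only [ad_apply, bracket, parity_apply]
    simp [h1, h2]
    abel
  · have h : ⁅S.oddBracket x y₁, z₁⁆ + ⁅S.oddBracket x z₁, y₁⁆ = -⁅S.oddBracket y₁ z₁, x⁆ := by
      rw [eq_neg_iff_add_eq_zero, ← S.jacobi x y₁ z₁, S.symm z₁ x]
      abel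
    simp only [ad_apply, bracket, parity_apply]
    simp only [zero_lie, add_lie, zero_add, zero_sub, lie_neg, sub_neg_eq_add, neg_add,
      lie_lie, ← h, Prod.snd_add]
    abel

theorem ad_ad (x y z : g₀ × g₁) :
    S.ad (S.ad x y) z = S.ad x (S.ad y z) - S.ad y (S.ad (x.1, 0) z) -
      S.ad (parity y) (S.ad (0, x.2) z) := by
  have hx : x = (x.1, 0) + (0, x.2) := by simp
  conv_lhs => rw [hx]
  conv_rhs => enter [1, 1]; rw [hx]
  simp only [map_add, LinearMap.add_apply, ad_even_ad, ad_odd_ad]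
  abel

/-! ### Generated subsuperalgebras -/

theorem subset_generated (s : Set (g₀ × g₁)) : s ⊆ S.generated s := by
  intro x hx
  simp only [generated, SetLike.mem_coe, Submodule.mem_sInf, Set.mem_ofPred_eq]
  exact fun T hT => hT.1 hx

theorem ad_mem_generated {s : Set (g₀ × g₁)} {x y : g₀ × g₁} (hx : x ∈ S.generated s)
    (hy : y ∈ S.generated s) : S.ad x y ∈ S.generated s := by
  simp only [generated, Submodule.mem_sInf, Set.mem_ofPred_eq] at *
  exact fun T hT => hT.2 x (hx T hT) y (hy T hT)

theorem generated_le {s : Set (g₀ × g₁)} {T : Submodule ℂ (g₀ × g₁)} (hs : s ⊆ T)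
    (hT : ∀ x ∈ T, ∀ y ∈ T, S.ad x y ∈ T) : S.generated s ≤ T :=
  sInf_le ⟨hs, hT⟩

/-- An element of `𝔤` is homogeneous if one of its two components vanishes. -/
def IsHomogeneous (x : g₀ × g₁) : Prop := x.2 = 0 ∨ x.1 = 0

theorem IsHomogeneous.parity_mem {x : g₀ × g₁} (hx : IsHomogeneous x)
    {T : Submodule ℂ (g₀ × g₁)} (h : x ∈ T) : parity x ∈ T := by
  obtain ⟨x₀, x₁⟩ := x
  rcases hx with hx | hx <;> simp only at hx <;> subst hx
  · simpa using h
  · simpa using T.neg_mem h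

/-- The Jacobi identity as a membership criterion, so that later inductions need not follow signs.
-/
theorem IsHomogeneous.ad_ad_mem {x y z : g₀ × g₁} (hx : IsHomogeneous x)
    {T : Submodule ℂ (g₀ × g₁)} (h₁ : S.ad (S.ad x y) z ∈ T) (h₂ : S.ad y (S.ad x z) ∈ T)
    (h₃ : S.ad (parity y) (S.ad x z) ∈ T) : S.ad x (S.ad y z) ∈ T := by
  obtain ⟨x₀, x₁⟩ := x
  rcases hx with hx | hx <;> simp only at hx <;> subst hx
  · rw [ad_even_ad]; exact T.add_mem h₁ h₂
  · rw [ad_odd_ad]; exact T.add_mem h₁ h₃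

theorem IsHomogeneous.ad_swap_mem {x y : g₀ × g₁} (hx : IsHomogeneous x)
    {T : Submodule ℂ (g₀ × g₁)} (h₁ : S.ad x y ∈ T) (h₂ : parity (S.ad x y) ∈ T) :
    S.ad y x ∈ T := by
  obtain ⟨x₀, x₁⟩ := x
  rcases hx with hx | hx <;> simp only at hx <;> subst hx
  · rw [ad_even_swap]; exact T.neg_mem h₁
  · rw [ad_odd_swap]; exact h₂

theorem parity_mem_generated {s : Set (g₀ × g₁)} (hs : ∀ x ∈ s, IsHomogeneous x)
    {x : g₀ × g₁} (hx : x ∈ S.generated s) : parity x ∈ S.generated s := by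
  refine S.generated_le (T := (S.generated s).comap parity) (fun y hy => ?_) (fun y hy z hz => ?_) hx
  · exact (hs y hy).parity_mem (S.subset_generated s hy)
  · rw [Submodule.mem_comap, parity_ad]
    exact S.ad_mem_generated hy hz

/-- The even component is the average of `x` and `parity x`; hence parity-stable subspaces are
graded. -/
theorem even_mem_of_parity_mem {T : Submodule ℂ (g₀ × g₁)} {x : g₀ × g₁} (hx : x ∈ T)
    (hx' : parity x ∈ T) : (x.1, (0 : g₁)) ∈ T := by
  have : (x.1, (0 : g₁)) = (1 / 2 : ℂ) • (x + parity x) := by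
    ext
    · simp only [parity_apply, Prod.smul_fst, Prod.fst_add]
      module
    · simp
  rw [this]
  exact T.smul_mem _ (T.add_mem hx hx')

theorem odd_mem_of_parity_mem {T : Submodule ℂ (g₀ × g₁)} {x : g₀ × g₁} (hx : x ∈ T)
    (hx' : parity x ∈ T) : ((0 : g₀), x.2) ∈ T := by
  have : ((0 : g₀), x.2) = x - (x.1, 0) := by ext <;> simp
  rw [this]
  exact T.sub_mem hx (even_mem_of_parity_mem hx hx')

/-- A subspace that is stable under the parity and under brackets with homogeneous generators is
stable under the bracket with all of `𝔤`. -/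
theorem ad_mem_of_generates {s : Set (g₀ × g₁)} (hs : S.generated s = ⊤)
    {T : Submodule ℂ (g₀ × g₁)} (hσ : ∀ x ∈ T, parity x ∈ T)
    (hT : ∀ x ∈ s, ∀ y ∈ T, S.ad x y ∈ T) (x : g₀ × g₁) {y : g₀ × g₁} (hy : y ∈ T) :
    S.ad x y ∈ T := by
  -- `K` is a subsuperalgebra by `ad_ad`. That formula involves the homogeneous components of an
  -- element, so `K` must also be parity-stable.
  let K : Submodule ℂ (g₀ × g₁) :=
    { carrier := {x | ∀ y ∈ T, S.ad x y ∈ T}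
      zero_mem' := fun y _ => by simp
      add_mem' := fun {a b} ha hb y hy => by
        rw [map_add, LinearMap.add_apply]; exact T.add_mem (ha y hy) (hb y hy)
      smul_mem' := fun c a ha y hy => by
        rw [map_smul, LinearMap.smul_apply]; exact T.smul_mem c (ha y hy) }
  have hKσ : ∀ x ∈ K, parity x ∈ K := fun x hx y hy => by
    have := hσ _ (hx _ (hσ y hy))
    rwa [parity_ad, parity_parity] at this
  have hK : S.generated s ≤ K := by
    refine S.generated_le hT fun a ha b hb y hy => ?_
    rw [ad_ad]
    refine T.sub_mem (T.sub_mem (ha _ (hb y hy)) (hb _ ?_)) (hKσ b hb _ ?_)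
    · exact even_mem_of_parity_mem ha (hKσ a ha) y hy
    · exact odd_mem_of_parity_mem ha (hKσ a ha) y hy
  exact hK (hs ▸ Submodule.mem_top) y hy

/-! ### Triangular decomposition -/

namespace ChevalleySystem

variable {S} {r : ℕ} (D : S.ChevalleySystem r)

/-- The Cartan subalgebra as a subspace of `𝔤`. -/
def cartanIncl : Submodule ℂ (g₀ × g₁) := D.cartan.map (LinearMap.inl ℂ g₀ g₁)

theorem isHomogeneous_e (i : Fin r) : IsHomogeneous (D.e i) := by
  by_cases h : D.colour i = .white
  · exact .inl (D.e_even i h)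
  · exact .inr (D.e_odd i h)

theorem isHomogeneous_f (i : Fin r) : IsHomogeneous (D.f i) := by
  by_cases h : D.colour i = .white
  · exact .inl (D.f_even i h)
  · exact .inr (D.f_odd i h)

theorem parity_mem_cartanIncl {x : g₀ × g₁} (hx : x ∈ D.cartanIncl) :
    parity x ∈ D.cartanIncl := by
  obtain ⟨y, hy, rfl⟩ := hx
  exact ⟨y, hy, by simp⟩

/-- If every coroot acts on the homogeneous elements `x i` by scalars, then `𝔥` normalizes the
subsuperalgebra generated by the `x i`. -/
theorem cartan_ad_mem_generated {x : Fin r → g₀ × g₁}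
    (hx : ∀ i j, ∃ c : ℂ, S.ad (D.coroot j, 0) (x i) = c • x i)
    {h : g₀} (hh : h ∈ D.cartan) {y : g₀ × g₁} (hy : y ∈ S.generated (Set.range x)) :
    S.ad (h, 0) y ∈ S.generated (Set.range x) := by
  -- The intersection keeps `a` and `b` themselves in the subalgebra, as the Leibniz rule requires.
  have key : ∀ j, S.generated (Set.range x) ≤
      S.generated (Set.range x) ⊓ (S.generated (Set.range x)).comap (S.ad (D.coroot j, 0)) := by
    intro j
    refine S.generated_le ?_ ?_
    · rintro _ ⟨i, rfl⟩
      have hi := S.subset_generated _ (Set.mem_range_self (f := x) i)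
      obtain ⟨c, hc⟩ := hx i j
      refine ⟨hi, ?_⟩
      rw [SetLike.mem_coe, Submodule.mem_comap, hc]
      exact Submodule.smul_mem _ _ hi
    · rintro a ⟨ha, ha'⟩ b ⟨hb, hb'⟩
      refine ⟨S.ad_mem_generated ha hb, ?_⟩
      rw [SetLike.mem_coe, Submodule.mem_comap, ad_even_ad]
      exact Submodule.add_mem _ (S.ad_mem_generated ha' hb) (S.ad_mem_generated ha hb')
  have : D.cartan ≤ ((S.generated (Set.range x)).comap (S.ad.flip y)).comap
      (LinearMap.inl ℂ g₀ g₁) := by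
    refine Submodule.span_le.2 ?_
    rintro _ ⟨j, rfl⟩
    exact (key j hy).2
  exact this hh

/-- Induction on brackets: in `[w, [a, b]] = [[w, a], b] ± [a, [w, b]]` the inner brackets lie in `𝔥
+ N`, which normalizes `N`. Applied with `w` an `e` and `x` the `f`'s, and conversely. -/
theorem ad_mem_cartan_sup_generated {x : Fin r → g₀ × g₁} (hom : ∀ i, IsHomogeneous (x i))
    (hx : ∀ i j, ∃ c : ℂ, S.ad (D.coroot j, 0) (x i) = c • x i)
    {w : g₀ × g₁} (hw : IsHomogeneous w) (hwx : ∀ i, S.ad w (x i) ∈ D.cartanIncl)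
    {y : g₀ × g₁} (hy : y ∈ S.generated (Set.range x)) :
    S.ad w y ∈ D.cartanIncl ⊔ S.generated (Set.range x) := by
  set N := S.generated (Set.range x) with hN
  have hσ : ∀ a ∈ N, parity a ∈ N := fun a ha =>
    S.parity_mem_generated (by rintro _ ⟨i, rfl⟩; exact hom i) ha
  have hl : ∀ a ∈ D.cartanIncl ⊔ N, ∀ b ∈ N, S.ad a b ∈ N := by
    intro a ha b hb
    obtain ⟨_, ⟨h, hh, rfl⟩, n, hn, rfl⟩ := Submodule.mem_sup.1 ha
    rw [map_add, LinearMap.add_apply]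
    exact N.add_mem (D.cartan_ad_mem_generated hx hh hb) (S.ad_mem_generated hn hb)
  have hr : ∀ a ∈ D.cartanIncl ⊔ N, ∀ b ∈ N, S.ad b a ∈ N := by
    intro a ha b hb
    obtain ⟨_, ⟨h, hh, rfl⟩, n, hn, rfl⟩ := Submodule.mem_sup.1 ha
    rw [map_add]
    refine N.add_mem ?_ (S.ad_mem_generated hb hn)
    rw [LinearMap.inl_apply, ad_even_swap]
    exact N.neg_mem (D.cartan_ad_mem_generated hx hh hb)
  have key : N ≤ N ⊓ (D.cartanIncl ⊔ N).comap (S.ad w) := by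
    refine S.generated_le ?_ ?_
    · rintro _ ⟨i, rfl⟩
      exact ⟨S.subset_generated _ (Set.mem_range_self i), Submodule.mem_sup_left (hwx i)⟩
    · rintro a ⟨ha, ha'⟩ b ⟨hb, hb'⟩
      refine ⟨S.ad_mem_generated ha hb, Submodule.mem_sup_right ?_⟩
      exact hw.ad_ad_mem S (hl _ ha' _ hb) (hr _ hb' _ ha) (hr _ hb' _ (hσ a ha))
  exact (key hy).2

theorem ad_coroot_e (i j : Fin r) : S.ad (D.coroot j, 0) (D.e i) = D.a j i • D.e i :=
  D.coroot_e i j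

theorem ad_coroot_f (i j : Fin r) : S.ad (D.coroot j, 0) (D.f i) = -(D.a j i) • D.f i :=
  D.coroot_f i j

theorem ad_e_f_mem (i j : Fin r) : S.ad (D.e i) (D.f j) ∈ D.cartanIncl := by
  rw [ad_apply, D.e_f]
  split_ifs
  · exact ⟨_, Submodule.subset_span (Set.mem_range_self i), rfl⟩
  · exact zero_mem _

theorem ad_f_e_mem (i j : Fin r) : S.ad (D.f j) (D.e i) ∈ D.cartanIncl :=
  (D.isHomogeneous_e i).ad_swap_mem S (D.ad_e_f_mem i j)
    (D.parity_mem_cartanIncl (D.ad_e_f_mem i j))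

/-- The triangular decomposition `𝔤 = 𝔫₋ + 𝔥 + 𝔫₊`. -/
theorem triangular : S.generated (Set.range D.f) ⊔ D.cartanIncl ⊔ S.generated (Set.range D.e) =
    ⊤ := by
  set P := S.generated (Set.range D.e) with hP
  set N := S.generated (Set.range D.f) with hN
  have hPσ : ∀ a ∈ P, parity a ∈ P := fun a ha =>
    S.parity_mem_generated (by rintro _ ⟨i, rfl⟩; exact D.isHomogeneous_e i) ha
  have hNσ : ∀ a ∈ N, parity a ∈ N := fun a ha =>
    S.parity_mem_generated (by rintro _ ⟨i, rfl⟩; exact D.isHomogeneous_f i) ha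
  have he : ∀ i j, ∃ c : ℂ, S.ad (D.coroot j, 0) (D.e i) = c • D.e i :=
    fun i j => ⟨_, D.ad_coroot_e i j⟩
  have hf : ∀ i j, ∃ c : ℂ, S.ad (D.coroot j, 0) (D.f i) = c • D.f i :=
    fun i j => ⟨_, D.ad_coroot_f i j⟩
  have heP : ∀ i, D.e i ∈ P := fun i => S.subset_generated _ (Set.mem_range_self i)
  have hfN : ∀ i, D.f i ∈ N := fun i => S.subset_generated _ (Set.mem_range_self i)
  set T := N ⊔ D.cartanIncl ⊔ P with hT
  have hNT : N ≤ T := le_sup_left.trans le_sup_left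
  have hHT : D.cartanIncl ≤ T := le_sup_right.trans le_sup_left
  have hPT : P ≤ T := le_sup_right
  have hTle : ∀ U : Submodule ℂ (g₀ × g₁), N ≤ U → D.cartanIncl ≤ U → P ≤ U → T ≤ U :=
    fun U h₁ h₂ h₃ => sup_le (sup_le h₁ h₂) h₃
  have hTσ : T ≤ T.comap parity := hTle _ (fun x hx => hNT (hNσ x hx))
    (fun x hx => hHT (D.parity_mem_cartanIncl hx)) (fun x hx => hPT (hPσ x hx))
  have hTe : ∀ i, T ≤ T.comap (S.ad (D.e i)) := by
    refine fun i => hTle _ (fun x hx => ?_) ?_ (fun x hx => hPT (S.ad_mem_generated (heP i) hx))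
    · exact sup_le hHT hNT (D.ad_mem_cartan_sup_generated D.isHomogeneous_f hf
        (D.isHomogeneous_e i) (D.ad_e_f_mem i) hx)
    · rintro _ ⟨h, hh, rfl⟩
      rw [Submodule.mem_comap, LinearMap.inl_apply, ad_even_swap]
      exact T.neg_mem (hPT (D.cartan_ad_mem_generated he hh (heP i)))
  have hTf : ∀ i, T ≤ T.comap (S.ad (D.f i)) := by
    refine fun i => hTle _ (fun x hx => hNT (S.ad_mem_generated (hfN i) hx)) ?_ (fun x hx => ?_)
    · rintro _ ⟨h, hh, rfl⟩
      rw [Submodule.mem_comap, LinearMap.inl_apply, ad_even_swap]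
      exact T.neg_mem (hNT (D.cartan_ad_mem_generated hf hh (hfN i)))
    · exact sup_le hHT hPT (D.ad_mem_cartan_sup_generated D.isHomogeneous_e he
        (D.isHomogeneous_f i) (fun j => D.ad_f_e_mem j i) hx)
  -- `T` contains the generators and is stable under bracketing with them, hence is stable under all
  -- of `𝔤` and in particular closed under the bracket.
  rw [eq_top_iff, ← D.generates]
  refine S.generated_le ?_ fun x _ y hy => S.ad_mem_of_generates D.generates hTσ ?_ x hy
  · rintro _ (⟨i, rfl⟩ | ⟨i, rfl⟩)
    · exact hPT (heP i)
    · exact hNT (hfN i)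
  · rintro _ (⟨i, rfl⟩ | ⟨i, rfl⟩) y hy
    · exact hTe i hy
    · exact hTf i hy

/-- `n̄₋`, the even part of the subsuperalgebra generated by the `f i`. -/
def nMinus : Submodule ℂ g₀ :=
  (S.generated (Set.range D.f)).comap (LinearMap.inl ℂ g₀ g₁)

/-- The triangular decomposition of the even part. -/
theorem triangular_even : D.nMinus ⊔ D.cartan ⊔ D.nPlus = ⊤ := by
  rw [eq_top_iff]
  intro x _
  have hx : (x, (0 : g₁)) ∈ S.generated (Set.range D.f) ⊔ D.cartanIncl ⊔
      S.generated (Set.range D.e) := D.triangular ▸ Submodule.mem_top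
  obtain ⟨_, hq, p, hp, h⟩ := Submodule.mem_sup.1 hx
  obtain ⟨n, hn, _, ⟨c, hc, rfl⟩, rfl⟩ := Submodule.mem_sup.1 hq
  have : x = n.1 + c + p.1 := by
    have := congrArg Prod.fst h
    simpa using this.symm
  rw [this]
  refine Submodule.add_mem_sup (Submodule.add_mem_sup ?_ hc) ?_
  · exact even_mem_of_parity_mem hn
      (S.parity_mem_generated (by rintro _ ⟨i, rfl⟩; exact D.isHomogeneous_f i) hn)
  · exact even_mem_of_parity_mem hp
      (S.parity_mem_generated (by rintro _ ⟨i, rfl⟩; exact D.isHomogeneous_e i) hp)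

/-! ### Nondegeneracy of the Cartan matrix -/

/-- An even element that commutes with all `e i` and `f i` vanishes when `𝔤` is simple. -/
theorem eq_zero_of_ad_eq_zero (hS : S.IsSimple) {x : g₀}
    (he : ∀ i, S.ad (x, 0) (D.e i) = 0) (hf : ∀ i, S.ad (x, 0) (D.f i) = 0) : x = 0 := by
  -- The centralizer of `x` is a subsuperalgebra containing the generators, so `x` is central.
  have hc : S.generated (Set.range D.e ∪ Set.range D.f) ≤ LinearMap.ker (S.ad (x, 0)) := by
    refine S.generated_le ?_ fun a ha b hb => ?_
    · rintro _ (⟨i, rfl⟩ | ⟨i, rfl⟩)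
      · exact he i
      · exact hf i
    · rw [LinearMap.mem_ker] at *
      rw [ad_even_ad, ha, hb]
      simp
  rw [D.generates] at hc
  have hc' : ∀ y, S.ad y (x, 0) = 0 := fun y => by
    rw [ad_even_swap, LinearMap.mem_ker.1 (hc Submodule.mem_top), neg_zero]
  have hmem : ∀ y ∈ (Submodule.span ℂ {x}).prod (⊥ : Submodule ℂ g₁), ∃ c : ℂ,
      y = c • (x, (0 : g₁)) := by
    rintro ⟨y₀, y₁⟩ ⟨h₀, h₁⟩
    obtain ⟨c, rfl⟩ := Submodule.mem_span_singleton.1 h₀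
    simp only [Submodule.bot_coe, Set.mem_singleton_iff] at h₁
    exact ⟨c, by simp [h₁]⟩
  have hxm : (x, (0 : g₁)) ∈ (Submodule.span ℂ {x}).prod (⊥ : Submodule ℂ g₁) :=
    ⟨Submodule.mem_span_singleton_self x, Submodule.zero_mem _⟩
  -- The line through a central element is a graded ideal; if it were all of `𝔤`, the bracket would
  -- vanish.
  rcases hS.ideal_trivial (Submodule.span ℂ {x}) ⊥ (fun y z hz => by
      obtain ⟨c, rfl⟩ := hmem z hz
      rw [← ad_apply, map_smul, hc', smul_zero]
      exact Submodule.zero_mem _) with h | h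
  · rw [h, Submodule.mem_bot] at hxm
    exact congrArg Prod.fst hxm
  · obtain ⟨y, z, hyz⟩ := hS.non_abelian
    obtain ⟨c, rfl⟩ := hmem z (h ▸ Submodule.mem_top)
    rw [← ad_apply, map_smul, hc', smul_zero] at hyz
    exact absurd rfl hyz

theorem ad_sum_coroot_e (c : Fin r → ℂ) (i : Fin r) :
    S.ad (∑ k, c k • D.coroot k, 0) (D.e i) = (∑ k, c k * D.a k i) • D.e i := by
  have : (∑ k, c k • D.coroot k, (0 : g₁)) = ∑ k, c k • (D.coroot k, (0 : g₁)) := by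
    ext <;> simp [Prod.fst_sum, Prod.snd_sum]
  rw [this, map_sum, LinearMap.sum_apply, Finset.sum_smul]
  refine Finset.sum_congr rfl fun k _ => ?_
  rw [map_smul, LinearMap.smul_apply, ad_coroot_e, smul_smul]

theorem ad_sum_coroot_f (c : Fin r → ℂ) (i : Fin r) :
    S.ad (∑ k, c k • D.coroot k, 0) (D.f i) = (-∑ k, c k * D.a k i) • D.f i := by
  have : (∑ k, c k • D.coroot k, (0 : g₁)) = ∑ k, c k • (D.coroot k, (0 : g₁)) := by
    ext <;> simp [Prod.fst_sum, Prod.snd_sum]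
  rw [this, map_sum, LinearMap.sum_apply, ← Finset.sum_neg_distrib, Finset.sum_smul]
  refine Finset.sum_congr rfl fun k _ => ?_
  rw [map_smul, LinearMap.smul_apply, ad_coroot_f, smul_smul, mul_neg]

/-- The Cartan matrix of a simple Lie superalgebra with independent coroots is invertible. -/
theorem isUnit_a (hS : S.IsSimple) : IsUnit D.a := by
  rw [← Matrix.vecMul_injective_iff_isUnit]
  refine (injective_iff_map_eq_zero (Matrix.vecMulLinear D.a)).2 fun c hc => ?_
  have hc' : ∀ i, ∑ k, c k * D.a k i = 0 := fun i => by
    simpa [Matrix.vecMul, dotProduct] using congrFun hc i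
  -- A left null vector of the Cartan matrix gives an element of `𝔥` commuting with every `e i` and
  -- `f i`.
  have h0 : ∑ k, c k • D.coroot k = 0 := D.eq_zero_of_ad_eq_zero hS
    (fun i => by rw [ad_sum_coroot_e, hc', zero_smul])
    (fun i => by rw [ad_sum_coroot_f, hc', neg_zero, zero_smul])
  exact funext (Fintype.linearIndependent_iff.1 D.coroot_indep c h0)

/-- The fundamental coweights: the simple roots have a dual basis in `𝔥`. -/
theorem exists_coweight (hS : S.IsSimple) (k : Fin r) :
    ∃ c : Fin r → ℂ, ∀ i, ∑ j, c j * D.a j i = if i = k then 1 else 0 := by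
  have hu := (Matrix.isUnit_iff_isUnit_det _).1 (D.isUnit_a hS)
  refine ⟨D.a⁻¹ k, fun i => ?_⟩
  have := congrFun (congrFun (Matrix.nonsing_inv_mul D.a hu) k) i
  rw [Matrix.mul_apply, Matrix.one_apply] at this
  simpa [eq_comm] using this

end ChevalleySystem

end LieSuperalgebra

namespace LieSuperalgebra

variable {g₀ g₁ : Type*} [LieRing g₀] [LieAlgebra ℂ g₀] [AddCommGroup g₁]
  [Module ℂ g₁] [LieRingModule g₀ g₁] [LieModule ℂ g₀ g₁] (S : LieSuperalgebra g₀ g₁)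

/-! ### Highest weight modules -/

/-- Serves both the superbracket on `𝔫₋` and the action of `n̄₋` on a module, where degrees add. -/
theorem bilin_mem_iSup {A B C : Type*} [AddCommGroup A] [Module ℂ A] [AddCommGroup B]
    [Module ℂ B] [AddCommGroup C] [Module ℂ C] (β : A →ₗ[ℂ] B →ₗ[ℂ] C)
    {G : ℕ → Submodule ℂ A} {H : ℕ → Submodule ℂ B} {K : ℕ → Submodule ℂ C}
    (h : ∀ m n, ∀ x ∈ G m, ∀ y ∈ H n, β x y ∈ K (m + n)) {x : A} {y : B}
    (hx : x ∈ ⨆ m, G m) (hy : y ∈ ⨆ m, H m) : β x y ∈ ⨆ m, K m := by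
  have h₁ : ∀ m, ∀ x ∈ G m, ⨆ n, H n ≤ (⨆ n, K n).comap (β x) := fun m x hx =>
    iSup_le fun n y hy => le_iSup K (m + n) (h m n x hx y hy)
  have h₂ : ⨆ m, G m ≤ (⨆ n, K n).comap (β.flip y) :=
    iSup_le fun m x hx => h₁ m x hx hy
  exact h₂ hx

namespace ChevalleySystem

variable {S} {r : ℕ} (D : S.ChevalleySystem r)

/-- The element `∑ j, c j • coroot j` of `𝔥`. -/
def cartanElt (c : Fin r → ℂ) : g₀ := ∑ j, c j • D.coroot j

theorem lie_cartanElt {V : Type*} [AddCommGroup V] [Module ℂ V] [LieRingModule g₀ V]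
    [LieModule ℂ g₀ V] (c μ : Fin r → ℂ) {w : V} (hw : w ∈ D.weightSpace V μ) :
    ⁅D.cartanElt c, w⁆ = (∑ j, c j * μ j) • w := by
  rw [cartanElt, sum_lie, Finset.sum_smul]
  refine Finset.sum_congr rfl fun j _ => ?_
  rw [smul_lie, hw j, smul_smul]

theorem exists_cartanElt {x : g₀} (hx : x ∈ D.cartan) : ∃ c, D.cartanElt c = x := by
  obtain ⟨c, hc⟩ := (Submodule.mem_span_range_iff_exists_fun ℂ).1 hx
  exact ⟨c, hc⟩

/-- The coweight `∑ j, c j • coroot j` is the fundamental coweight dual to the simple root `k`. -/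
def IsCoweight (c : Fin r → ℂ) (k : Fin r) : Prop :=
  ∀ i, ∑ j, c j * D.a j i = if i = k then 1 else 0

variable {D} {c : Fin r → ℂ} {k : Fin r}

/-- `𝔫̄₋` is graded by a fundamental coweight in nonpositive integral degrees. -/
theorem IsCoweight.nMinus_le (hc : D.IsCoweight c k) : D.nMinus ≤
    ⨆ m : ℕ, (LieModule.toEnd ℂ g₀ g₀ (D.cartanElt c)).eigenspace (-(m : ℂ)) := by
  have h : S.generated (Set.range D.f) ≤
      ⨆ m : ℕ, Module.End.eigenspace (S.ad (D.cartanElt c, 0)) (-(m : ℂ)) := by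
    refine S.generated_le ?_ fun x hx y hy => ?_
    · rintro _ ⟨i, rfl⟩
      -- `f k` has degree `-1` and the other `f i` have degree `0`.
      refine Submodule.mem_iSup_of_mem (if i = k then 1 else 0) ?_
      rw [Module.End.mem_eigenspace_iff, cartanElt, ad_sum_coroot_f, hc]
      split_ifs <;> simp
    · refine bilin_mem_iSup S.ad
        (G := fun m : ℕ => Module.End.eigenspace (S.ad (D.cartanElt c, 0)) (-(m : ℂ)))
        (H := fun m : ℕ => Module.End.eigenspace (S.ad (D.cartanElt c, 0)) (-(m : ℂ)))
        (K := fun m : ℕ => Module.End.eigenspace (S.ad (D.cartanElt c, 0)) (-(m : ℂ)))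
        (fun m n x hx y hy => ?_) hx hy
      replace hx := Module.End.mem_eigenspace_iff.1 hx
      replace hy := Module.End.mem_eigenspace_iff.1 hy
      refine Module.End.mem_eigenspace_iff.2 ?_
      rw [ad_even_ad, hx, hy, map_smul, map_smul, LinearMap.smul_apply, ← add_smul]
      push_cast
      congr 1
      ring
  intro x hx
  have hx' := Submodule.mem_map_of_mem (f := LinearMap.fst ℂ g₀ g₁) (h hx)
  rw [Submodule.map_iSup] at hx'
  revert hx'
  apply SetLike.le_def.1
  refine iSup_mono fun m => ?_
  rintro _ ⟨y, hy, rfl⟩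
  rw [SetLike.mem_coe, Module.End.mem_eigenspace_iff] at hy
  rw [Module.End.mem_eigenspace_iff]
  have := congrArg Prod.fst hy
  simpa [ad_apply, bracket] using this

section Modules

variable {V : Type*} [AddCommGroup V] [Module ℂ V] [LieRingModule g₀ V] [LieModule ℂ g₀ V]
  {μ : Fin r → ℂ}

/-- On a highest weight module a fundamental coweight has eigenvalues in `μ - ℕ`. -/
theorem IsCoweight.iSup_eigenspace_eq_top (hc : D.IsCoweight c k)
    (hV : D.IsIrreducibleHighestWeight V μ) :
    ⨆ m : ℕ, (LieModule.toEnd ℂ g₀ V (D.cartanElt c)).eigenspace (∑ j, c j * μ j - (m : ℂ)) =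
      ⊤ := by
  obtain ⟨hirr, v, hv0, hvμ, hvn⟩ := hV
  set B := ⨆ m : ℕ, (LieModule.toEnd ℂ g₀ V (D.cartanElt c)).eigenspace
    (∑ j, c j * μ j - (m : ℂ)) with hB
  -- `M` is `U(n̄₋) v`. It is graded in the wanted degrees; the rest shows that it is a submodule.
  let M : Submodule ℂ V := sInf {T | v ∈ T ∧ ∀ x ∈ D.nMinus, ∀ y ∈ T, ⁅x, y⁆ ∈ T}
  have hvM : v ∈ M := Submodule.mem_sInf.2 fun T hT => hT.1
  have hnM : ∀ x ∈ D.nMinus, ∀ y ∈ M, ⁅x, y⁆ ∈ M := fun x hx y hy =>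
    Submodule.mem_sInf.2 fun T hT => hT.2 x hx y (Submodule.mem_sInf.1 hy T hT)
  have hMB : M ≤ B := by
    refine sInf_le ⟨Submodule.mem_iSup_of_mem 0 ?_, fun x hx y hy => ?_⟩
    · rw [Module.End.mem_eigenspace_iff, LieModule.toEnd_apply_apply, D.lie_cartanElt c μ hvμ]
      simp
    · refine bilin_mem_iSup (LieModule.toEnd ℂ g₀ V : g₀ →ₗ[ℂ] V →ₗ[ℂ] V)
        (G := fun m : ℕ => (LieModule.toEnd ℂ g₀ g₀ (D.cartanElt c)).eigenspace (-(m : ℂ)))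
        (H := fun m : ℕ =>
          (LieModule.toEnd ℂ g₀ V (D.cartanElt c)).eigenspace (∑ j, c j * μ j - (m : ℂ)))
        (K := fun m : ℕ =>
          (LieModule.toEnd ℂ g₀ V (D.cartanElt c)).eigenspace (∑ j, c j * μ j - (m : ℂ)))
        (fun m n x hx y hy => ?_) (hc.nMinus_le hx) hy
      replace hx := Module.End.mem_eigenspace_iff.1 hx
      replace hy := Module.End.mem_eigenspace_iff.1 hy
      refine Module.End.mem_eigenspace_iff.2 ?_
      rw [LieModule.toEnd_apply_apply] at hx hy ⊢
      simp only [LieHom.coe_toLinearMap, LieModule.toEnd_apply_apply]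
      rw [leibniz_lie, hx, hy, smul_lie, lie_smul, ← add_smul]
      push_cast
      congr 1
      ring
  let K : Submodule ℂ V :=
    { carrier := {w | w ∈ M ∧ ∀ x : g₀, ⁅x, w⁆ ∈ M}
      zero_mem' := ⟨M.zero_mem, fun x => by rw [lie_zero]; exact M.zero_mem⟩
      add_mem' := fun ha hb => ⟨M.add_mem ha.1 hb.1, fun x => by
        rw [lie_add]; exact M.add_mem (ha.2 x) (hb.2 x)⟩
      smul_mem' := fun c _ ha => ⟨M.smul_mem c ha.1, fun x => by
        rw [lie_smul]; exact M.smul_mem c (ha.2 x)⟩ }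
  have hMK : M ≤ K := by
    -- At `v` the triangular decomposition applies. In the inductive step `x n y = [x, n] y + n x
    -- y`, where `[x, n]` is arbitrary in `𝔤₀`; this is why `K` quantifies over all `x`.
    refine sInf_le ⟨⟨hvM, fun x => ?_⟩, fun n hn y hy => ⟨hnM n hn y hy.1, fun x => ?_⟩⟩
    · have hx : x ∈ D.nMinus ⊔ D.cartan ⊔ D.nPlus := D.triangular_even ▸ Submodule.mem_top
      obtain ⟨_, hq, p, hp, rfl⟩ := Submodule.mem_sup.1 hx
      obtain ⟨n, hn, h, hh, rfl⟩ := Submodule.mem_sup.1 hq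
      obtain ⟨b, rfl⟩ := D.exists_cartanElt hh
      rw [add_lie, add_lie, hvn p hp, add_zero, D.lie_cartanElt b μ hvμ]
      exact M.add_mem (hnM n hn v hvM) (M.smul_mem _ hvM)
    · rw [leibniz_lie]
      exact M.add_mem (hy.2 _) (hnM n hn _ (hy.2 x))
  let U : LieSubmodule ℂ g₀ V := { M with lie_mem := fun {x w} hw => (hMK hw).2 x }
  have hU : U = ⊤ := by
    refine (eq_bot_or_eq_top U).resolve_left fun h => hv0 ?_
    have : v ∈ U := hvM
    rwa [h, LieSubmodule.mem_bot] at this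
  rw [eq_top_iff]
  intro w _
  have : w ∈ U := hU ▸ LieSubmodule.mem_top w
  exact hMB this

/-- An element of degree one kills every vector whose degree equals that of the highest weight. -/
theorem IsCoweight.lie_eq_zero (hc : D.IsCoweight c k) (hV : D.IsIrreducibleHighestWeight V μ)
    {x : g₀} (hx : ⁅D.cartanElt c, x⁆ = x) {w : V}
    (hw : ⁅D.cartanElt c, w⁆ = (∑ j, c j * μ j) • w) : ⁅x, w⁆ = 0 := by
  have h₁ : ⁅x, w⁆ ∈ (LieModule.toEnd ℂ g₀ V (D.cartanElt c)).eigenspace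
      (∑ j, c j * μ j + 1) := by
    rw [Module.End.mem_eigenspace_iff, LieModule.toEnd_apply_apply, leibniz_lie, hx, hw, lie_smul,
      add_smul, one_smul, add_comm]
  -- Eigenspaces are independent and top degree plus one is never top degree minus `m`, so this
  -- eigenspace is zero.
  have h₂ := (Module.End.eigenspaces_iSupIndep (LieModule.toEnd ℂ g₀ V (D.cartanElt c)))
    (∑ j, c j * μ j + 1)
  refine Submodule.disjoint_def.1 h₂ _ h₁ ?_
  have h₃ : ⁅x, w⁆ ∈ ⨆ m : ℕ, (LieModule.toEnd ℂ g₀ V (D.cartanElt c)).eigenspace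
      (∑ j, c j * μ j - (m : ℂ)) := hc.iSup_eigenspace_eq_top hV ▸ Submodule.mem_top
  revert h₃
  apply SetLike.le_def.1
  refine iSup_le fun m => ?_
  refine le_iSup₂_of_le (∑ j, c j * μ j - (m : ℂ)) (fun h => ?_) le_rfl
  have h' : ((m + 1 : ℕ) : ℂ) = 0 := by
    push_cast
    linear_combination -h
  exact absurd (Nat.cast_eq_zero.1 h') (Nat.succ_ne_zero m)

theorem IsCoweight.lie_eBracket (hc : D.IsCoweight c k) (i j : Fin r) :
    ⁅D.cartanElt c, D.eBracket i j⁆ =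
      ((if i = k then 1 else 0 : ℂ) + if j = k then 1 else 0) • D.eBracket i j := by
  have h := S.ad_even_ad (D.cartanElt c) (D.e i) (D.e j)
  rw [cartanElt, ad_sum_coroot_e, ad_sum_coroot_e, hc, hc, map_smul, map_smul,
    LinearMap.smul_apply, ← add_smul] at h
  have := congrArg Prod.fst h
  simpa [ad_apply, bracket, eBracket, cartanElt] using this

variable (D) in
/-- The weight of the lower of the two weight spaces that make up `W_i` (for grey nodes, the
highest weight). -/
noncomputable def lowerWeight (i : Fin r) : Fin r → ℂ :=
  match D.colour i with
  | .white => D.highestWeight i - D.simpleRoot i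
  | .black => D.highestWeight i - (2 : ℂ) • D.simpleRoot i
  | .grey => D.highestWeight i

variable (D V) in
theorem W_eq (i : Fin r) : D.W V i =
    D.weightSpace V (D.highestWeight i) ⊔ D.weightSpace V (D.lowerWeight i) := by
  cases h : D.colour i <;> simp [W, lowerWeight, h]

variable (D) in
-- Only `α_i` is subtracted, so coweights dual to other roots do not see the difference; integrality
-- of `n` makes the lower weight a character of `H`.
theorem exists_lowerWeight_eq (i : Fin r) :
    ∃ n : ℤ, D.lowerWeight i = D.highestWeight i - (n : ℂ) • D.simpleRoot i := by
  unfold lowerWeight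
  split
  · exact ⟨1, by simp⟩
  · exact ⟨2, by simp⟩
  · exact ⟨0, by simp⟩

/-- `[e_k, e_l]` kills `W_i` for `k ≠ l`. -/
theorem lie_eBracket_eq_zero (hS : S.IsSimple) {i : Fin r}
    (hV : D.IsIrreducibleHighestWeight V (D.highestWeight i)) {p q : Fin r} (hpq : p ≠ q)
    {w : V} (hw : w ∈ D.W V i) : ⁅D.eBracket p q, w⁆ = 0 := by
  -- As `p ≠ q`, exactly one of them equals `k`, so `[e_p, e_q]` has degree one for the coweight
  -- dual to `α_k`.
  obtain ⟨k, hk, hki⟩ : ∃ k, (k = p ∨ k = q) ∧ i ≠ k := by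
    by_cases h : i = p
    · exact ⟨q, .inr rfl, h ▸ hpq⟩
    · exact ⟨p, .inl rfl, h⟩
  obtain ⟨c, hc⟩ : ∃ c, D.IsCoweight c k := D.exists_coweight hS k
  have hx : ⁅D.cartanElt c, D.eBracket p q⁆ = D.eBracket p q := by
    rw [hc.lie_eBracket]
    rcases hk with rfl | rfl
    · simp [hpq.symm]
    · simp [hpq]
  rw [W_eq] at hw
  obtain ⟨w₁, h₁, w₂, h₂, rfl⟩ := Submodule.mem_sup.1 hw
  rw [lie_add, hc.lie_eq_zero hV hx (D.lie_cartanElt c _ h₁), zero_add]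
  refine hc.lie_eq_zero hV hx ?_
  rw [D.lie_cartanElt c _ h₂]
  obtain ⟨n, hn⟩ := D.exists_lowerWeight_eq i
  congr 1
  have h0 := hc i
  rw [if_neg hki] at h0
  simp only [hn, Pi.sub_apply, Pi.smul_apply, smul_eq_mul, simpleRoot, mul_sub,
    Finset.sum_sub_distrib, mul_left_comm (c _)]
  rw [← Finset.mul_sum, h0, mul_zero, sub_zero]

end Modules

end ChevalleySystem

end LieSuperalgebra

namespace LieSuperalgebra

namespace ChevalleySystem

variable {g₀ g₁ : Type*} [LieRing g₀] [LieAlgebra ℂ g₀] [AddCommGroup g₁]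
  [Module ℂ g₁] [LieRingModule g₀ g₁] [LieModule ℂ g₀ g₁] {S : LieSuperalgebra g₀ g₁}
  {r : ℕ} (D : S.ChevalleySystem r)

/-! ### Exponentials -/

theorem IsExp.apply_eq_self {M : Type*} [AddCommGroup M] [Module RF M] {X : Module.End RF M}
    {E : M ≃ₗ[RF] M} (hE : IsExp X E) {w : M} (hw : X w = 0) : E w = w := by
  obtain ⟨N, hN, hEw⟩ := hE w
  have hpow : ∀ n, (X ^ (n + 1)) w = 0 := fun n => by
    rw [pow_succ, Module.End.mul_apply, hw, map_zero]
  -- For `N = 0` the exponential sum is empty, but then `X ^ 0` kills `w`, so `w = 0`.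
  cases N with
  | zero =>
    have : w = 0 := hN
    rw [this, map_zero]
  | succ N =>
    rw [hEw, Finset.sum_range_succ', Finset.sum_eq_zero fun n _ => by rw [hpow, smul_zero]]
    simp

theorem eBracket_mem_nPlus {i j : Fin r} (hij : D.colour i = .white ↔ D.colour j = .white) :
    D.eBracket i j ∈ D.nPlus := by
  have h : (D.eBracket i j, (0 : g₁)) = S.ad (D.e i) (D.e j) := by
    refine Prod.ext rfl ?_
    by_cases hi : D.colour i = .white
    · simp [ad_apply, bracket, D.e_even i hi, D.e_even j (hij.1 hi)]
    · simp [ad_apply, bracket, D.e_odd i hi, D.e_odd j (fun h => hi (hij.2 h))]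
  change (D.eBracket i j, (0 : g₁)) ∈ S.generated (Set.range D.e)
  rw [h]
  exact S.ad_mem_generated (S.subset_generated _ (Set.mem_range_self i))
    (S.subset_generated _ (Set.mem_range_self j))

/-! ### Integrality of the weights on the torus -/

/-- Otherwise `coroot i = [e_i, f_i]` would vanish. Needed to cancel `e i` in `root_integral`. -/
theorem e_ne_zero (i : Fin r) : D.e i ≠ 0 := by
  intro h
  have h' := D.e_f i i
  rw [h, ← ad_apply, map_zero, LinearMap.zero_apply, if_pos rfl] at h'
  exact D.coroot_indep.ne_zero i (congrArg Prod.fst h').symm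

/-- The factor `1` or `1/2` by which `coroot' i` differs from `coroot i`. -/
noncomputable def corootScale (i : Fin r) : ℂ := if D.colour i = .black then 1 / 2 else 1

theorem coroot'_eq (i : Fin r) : D.coroot' i = D.corootScale i • D.coroot i := by
  unfold coroot' corootScale
  split_ifs <;> simp

variable {D} (T : D.Torus)

/-- The coordinates of the `j`-th basic cocharacter in the basis of simple coroots. -/
noncomputable def Torus.coords (j : Fin r) : Fin r → ℂ := fun k => T.coeff j k * D.corootScale k

theorem Torus.cochar_eq (j : Fin r) : T.cochar j = D.cartanElt (T.coords j) := by
  unfold Torus.cochar cartanElt Torus.coords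
  exact Finset.sum_congr rfl fun k _ => by rw [coroot'_eq, smul_smul]

/-- A weight of `𝔥` that is a character of the torus `H`. -/
def Torus.IsCharacter (μ : Fin r → ℂ) : Prop :=
  ∀ j, ∃ n : ℤ, ∑ k, T.coords j k * μ k = n

/-- At a black node the `1/2` in `coroot'` cancels the `2` in `2 ω_i`, so the pairing is always an
entry of `coeff`. -/
theorem Torus.isCharacter_highestWeight (i : Fin r) : T.IsCharacter (D.highestWeight i) := by
  intro j
  refine ⟨T.coeff j i, ?_⟩
  unfold highestWeight fundWeight Torus.coords corootScale
  split_ifs with h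
  · rw [Finset.sum_eq_single i (fun k _ hk => by simp [hk]) (by simp)]
    simp [h]
  · rw [Finset.sum_eq_single i (fun k _ hk => by simp [hk]) (by simp)]
    simp [h]

theorem Torus.isCharacter_simpleRoot (i : Fin r) : T.IsCharacter (D.simpleRoot i) := by
  intro j
  obtain ⟨n, hn⟩ := T.root_integral i j
  refine ⟨n, smul_left_injective ℂ (D.e_ne_zero i) ?_⟩
  have h : S.bracket (T.cochar j, 0) (D.e i) = (n : ℂ) • D.e i := hn
  rw [T.cochar_eq, ← ad_apply, cartanElt, ad_sum_coroot_e] at h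
  exact h

theorem Torus.isCharacter_lowerWeight (i : Fin r) : T.IsCharacter (D.lowerWeight i) := by
  intro j
  obtain ⟨m, hm⟩ := D.exists_lowerWeight_eq i
  obtain ⟨p, hp⟩ := T.isCharacter_highestWeight i j
  obtain ⟨q, hq⟩ := T.isCharacter_simpleRoot i j
  refine ⟨p - m * q, ?_⟩
  simp only [hm, Pi.sub_apply, Pi.smul_apply, smul_eq_mul, mul_sub, Finset.sum_sub_distrib,
    mul_left_comm (T.coords j _) (m : ℂ)]
  rw [← Finset.mul_sum, hp, hq]
  push_cast
  rfl

section Modules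

variable {V : Type*} [AddCommGroup V] [Module ℂ V] [LieRingModule g₀ V] [LieModule ℂ g₀ V]

theorem connection_tmul (x : g₀) (f : RF) (w : V) :
    connection V (1 ⊗ₜ[ℂ] x) (f ⊗ₜ[ℂ] w) = RF.dz f ⊗ₜ[ℂ] w + f ⊗ₜ[ℂ] ⁅x, w⁆ := by
  simp [connection]

/-- A constant element of the torus acts by a constant scalar on the vectors whose weight is a
character. -/
theorem Torus.IsAction.const_apply {t : Fin r → ℂˣ} {E : (RF ⊗[ℂ] V) ≃ₗ[RF] (RF ⊗[ℂ] V)}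
    (hE : T.IsAction (fun j => Units.map (algebraMap ℂ RF : ℂ →* RF) (t j)) E)
    {μ : Fin r → ℂ} (hμ : T.IsCharacter μ) :
    ∃ c : ℂˣ, ∀ w ∈ D.weightSpace V μ, ∀ f : RF, E (f ⊗ₜ[ℂ] w) = f ⊗ₜ[ℂ] ((c : ℂ) • w) := by
  choose n hn using hμ
  refine ⟨∏ j, t j ^ n j, fun w hw f => ?_⟩
  have h := hE n w fun j => by rw [T.cochar_eq, D.lie_cartanElt _ _ hw, hn]
  have hc : ((∏ j, Units.map (algebraMap ℂ RF : ℂ →* RF) (t j) ^ n j : RFˣ) : RF) =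
      algebraMap ℂ RF ((∏ j, t j ^ n j : ℂˣ) : ℂ) := by
    have : (∏ j, Units.map (algebraMap ℂ RF : ℂ →* RF) (t j) ^ n j : RFˣ) =
        Units.map (algebraMap ℂ RF : ℂ →* RF) (∏ j, t j ^ n j) := by
      rw [map_prod]
      exact Finset.prod_congr rfl fun j _ => (map_zpow _ _ _).symm
    rw [this]
    rfl
  have hf : f ⊗ₜ[ℂ] w = f • ((1 : RF) ⊗ₜ[ℂ] w) := by
    rw [TensorProduct.smul_tmul', smul_eq_mul, mul_one]
  -- A constant scalar crosses the tensor product over `ℂ` to the factor `V`, out of reach of `∂_z`.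
  rw [hf, map_smul, h, hc, TensorProduct.smul_tmul', smul_eq_mul, mul_comm, ← Algebra.smul_def,
    TensorProduct.smul_tmul]

end Modules

/-! ### Stabilizers of `W_i(z)` and the Miura-Plücker condition -/

variable {V : Fin r → Type*} [∀ i, AddCommGroup (V i)] [∀ i, Module ℂ (V i)]
  [∀ i, LieRingModule g₀ (V i)] [∀ i, LieModule ℂ g₀ (V i)]

theorem inclW_tmul (i : Fin r) (f : RF) (w : D.W (V i) i) :
    D.inclW V i (f ⊗ₜ[ℂ] w) = f ⊗ₜ[ℂ] (w : V i) := by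
  simp [inclW]

theorem inclW_injective (i : Fin r) : Function.Injective (D.inclW V i) :=
  Module.Flat.lTensor_preserves_injective_linearMap (M := RF) (D.W (V i) i).subtype
    (Submodule.injective_subtype _)

/-- Induction over `W_i(z)`: the pure tensors with a vector of one of the two weights generate. -/
theorem inclW_induction (i : Fin r) {p : RF ⊗[ℂ] V i → Prop}
    (hadd : ∀ x y, p x → p y → p (x + y))
    (htmul : ∀ μ, (μ = D.highestWeight i ∨ μ = D.lowerWeight i) →
      ∀ w ∈ D.weightSpace (V i) μ, ∀ f : RF, p (f ⊗ₜ[ℂ] w))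
    (x : RF ⊗[ℂ] D.W (V i) i) : p (D.inclW V i x) := by
  induction x with
  | zero =>
    have := htmul _ (.inl rfl) 0 (Submodule.zero_mem _) 0
    rwa [TensorProduct.zero_tmul, ← map_zero (D.inclW V i)] at this
  | add x y hx hy => rw [map_add]; exact hadd _ _ hx hy
  | tmul f w =>
    rw [inclW_tmul]
    obtain ⟨w, hw⟩ := w
    rw [W_eq] at hw
    obtain ⟨w₁, h₁, w₂, h₂, rfl⟩ := Submodule.mem_sup.1 hw
    simp only [TensorProduct.tmul_add]
    exact hadd _ _ (htmul _ (.inl rfl) _ h₁ f) (htmul _ (.inr rfl) _ h₂ f)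

theorem tmul_mem_range_inclW (i : Fin r) {μ : Fin r → ℂ}
    (hμ : μ = D.highestWeight i ∨ μ = D.lowerWeight i) {w : V i}
    (hw : w ∈ D.weightSpace (V i) μ) (f : RF) : f ⊗ₜ[ℂ] w ∈ LinearMap.range (D.inclW V i) := by
  have hW : w ∈ D.W (V i) i := by
    rw [W_eq]
    rcases hμ with rfl | rfl
    · exact Submodule.mem_sup_left hw
    · exact Submodule.mem_sup_right hw
  exact ⟨f ⊗ₜ[ℂ] ⟨w, hW⟩, inclW_tmul i f _⟩

theorem Torus.isCharacter_of_eq (i : Fin r) {μ : Fin r → ℂ}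
    (hμ : μ = D.highestWeight i ∨ μ = D.lowerWeight i) : T.IsCharacter μ := by
  rcases hμ with rfl | rfl
  · exact T.isCharacter_highestWeight i
  · exact T.isCharacter_lowerWeight i

variable (D V) in
/-- The elements of the ambient group that preserve every `W_i(z)` and commute with `∂_z + Z` on
it. -/
def flatStabilizer (Z : g₀) : Subgroup (Ambient g₀ V) where
  -- Taking `bi` invertible says that `b` maps `W_i(z)` onto itself, which gives closure under
  -- inverses.
  carrier := {b | ∀ i, ∃ bi : (RF ⊗[ℂ] (D.W (V i) i)) ≃ₗ[RF] (RF ⊗[ℂ] (D.W (V i) i)),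
    ∀ w, D.inclW V i (bi w) = b.2.2 i (D.inclW V i w) ∧
      connection (V i) (1 ⊗ₜ[ℂ] Z) (b.2.2 i (D.inclW V i w)) =
        b.2.2 i (connection (V i) (1 ⊗ₜ[ℂ] Z) (D.inclW V i w))}
  one_mem' := fun i => ⟨LinearEquiv.refl _ _, fun w => ⟨rfl, rfl⟩⟩
  mul_mem' := fun {a b} ha hb i => by
    obtain ⟨ai, hai⟩ := ha i
    obtain ⟨bi, hbi⟩ := hb i
    refine ⟨bi.trans ai, fun w => ⟨?_, ?_⟩⟩
    · change D.inclW V i (ai (bi w)) = a.2.2 i (b.2.2 i (D.inclW V i w))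
      rw [(hai _).1, (hbi w).1]
    · change connection (V i) (1 ⊗ₜ[ℂ] Z) (a.2.2 i (b.2.2 i (D.inclW V i w))) =
        a.2.2 i (b.2.2 i (connection (V i) (1 ⊗ₜ[ℂ] Z) (D.inclW V i w)))
      rw [← (hbi w).1, (hai _).2, (hbi w).1, (hbi w).2]
  inv_mem' := fun {a} ha i => by
    obtain ⟨ai, hai⟩ := ha i
    have h : ∀ w, D.inclW V i (ai.symm w) = (a.2.2 i).symm (D.inclW V i w) := fun w => by
      rw [LinearEquiv.eq_symm_apply, ← (hai _).1, LinearEquiv.apply_symm_apply]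
    refine ⟨ai.symm, fun w => ⟨h w, ?_⟩⟩
    change connection (V i) (1 ⊗ₜ[ℂ] Z) ((a.2.2 i).symm (D.inclW V i w)) =
      (a.2.2 i).symm (connection (V i) (1 ⊗ₜ[ℂ] Z) (D.inclW V i w))
    rw [LinearEquiv.eq_symm_apply, ← h, ← (hai _).2, h, LinearEquiv.apply_symm_apply]

/-- On each weight space in `W_i` both the torus element and `Z` are constant scalars, so they
commute with each other and with `∂_z`. -/
theorem constTorus_le_flatStabilizer {Z : g₀} (hZ : Z ∈ D.cartan) :
    D.constTorus V T ≤ D.flatStabilizer V Z := by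
  refine (Subgroup.closure_le _).2 ?_
  rintro b ⟨t, -, -, hb⟩ i
  obtain ⟨z, rfl⟩ := D.exists_cartanElt hZ
  set E := b.2.2 i with hE
  have hact : ∀ μ, (μ = D.highestWeight i ∨ μ = D.lowerWeight i) → ∃ c : ℂˣ,
      ∀ w ∈ D.weightSpace (V i) μ, ∀ f : RF, E (f ⊗ₜ[ℂ] w) = f ⊗ₜ[ℂ] ((c : ℂ) • w) :=
    fun μ hμ => (hb i).const_apply T (T.isCharacter_of_eq i hμ)
  have h₁ : ∀ x, E (D.inclW V i x) ∈ LinearMap.range (D.inclW V i) := by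
    refine inclW_induction i (p := fun y => E y ∈ LinearMap.range (D.inclW V i))
      (fun x y hx hy => ?_) (fun μ hμ w hw f => ?_)
    · rw [map_add]; exact Submodule.add_mem _ hx hy
    · obtain ⟨c, hc⟩ := hact μ hμ
      rw [hc w hw]
      exact tmul_mem_range_inclW i hμ (Submodule.smul_mem _ _ hw) f
  have h₂ : ∀ x, E.symm (D.inclW V i x) ∈ LinearMap.range (D.inclW V i) := by
    refine inclW_induction i (p := fun y => E.symm y ∈ LinearMap.range (D.inclW V i))
      (fun x y hx hy => ?_) (fun μ hμ w hw f => ?_)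
    · rw [map_add]; exact Submodule.add_mem _ hx hy
    · obtain ⟨c, hc⟩ := hact μ hμ
      have : E.symm (f ⊗ₜ[ℂ] w) = f ⊗ₜ[ℂ] (((c⁻¹ : ℂˣ) : ℂ) • w) := by
        rw [LinearEquiv.symm_apply_eq, hc _ (Submodule.smul_mem _ _ hw), smul_smul,
          Units.mul_inv, one_smul]
      rw [this]
      exact tmul_mem_range_inclW i hμ (Submodule.smul_mem _ _ hw) f
  have hmap : (LinearMap.range (D.inclW V i)).map (E : _ →ₗ[RF] _) =
      LinearMap.range (D.inclW V i) := by
    apply le_antisymm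
    · rintro _ ⟨_, ⟨x, rfl⟩, rfl⟩
      exact h₁ x
    · rintro _ ⟨x, rfl⟩
      exact ⟨_, h₂ x, E.apply_symm_apply _⟩
  let ι := LinearEquiv.ofInjective (D.inclW V i) (inclW_injective i)
  refine ⟨(ι.trans (E.ofSubmodules _ _ hmap)).trans ι.symm, fun x => ⟨?_, ?_⟩⟩
  · have : ∀ y, D.inclW V i (ι.symm y) = y := fun y => congrArg Subtype.val (ι.apply_symm_apply y)
    rw [LinearEquiv.trans_apply, this]
    rfl
  · refine inclW_induction i (p := fun y => connection (V i) (1 ⊗ₜ[ℂ] D.cartanElt z) (E y) =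
      E (connection (V i) (1 ⊗ₜ[ℂ] D.cartanElt z) y)) (fun x y hx hy => ?_)
      (fun μ hμ w hw f => ?_) x
    · rw [map_add, map_add, map_add, map_add, hx, hy]
    · obtain ⟨c, hc⟩ := hact μ hμ
      rw [hc w hw, connection_tmul, connection_tmul, map_add, hc w hw, lie_smul,
        D.lie_cartanElt z μ hw, hc _ (Submodule.smul_mem _ _ hw)]

variable (D V) in
/-- The elements of the ambient group that fix every `W_i(z)` pointwise. -/
def pointwiseStabilizer : Subgroup (Ambient g₀ V) where
  carrier := {b | ∀ i w, b.2.2 i (D.inclW V i w) = D.inclW V i w}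
  one_mem' := fun i w => rfl
  mul_mem' := fun {a b} ha hb i w => by
    change a.2.2 i (b.2.2 i (D.inclW V i w)) = _
    rw [hb, ha]
  inv_mem' := fun {a} ha i w => by
    change (a.2.2 i).symm (D.inclW V i w) = _
    rw [LinearEquiv.symm_apply_eq, ha]

/-- The exponent of each generator kills `W_i(z)`, so its exponential is the identity there. -/
theorem nTilde_le_pointwiseStabilizer (hS : S.IsSimple)
    (hV : ∀ i, D.IsIrreducibleHighestWeight (V i) (D.highestWeight i)) :
    D.nTilde V ≤ D.pointwiseStabilizer V := by
  refine (Subgroup.closure_le _).2 ?_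
  rintro b ⟨p, q, hpq, -, a, -, -, hb⟩ i w
  refine (hb i).apply_eq_self ?_
  induction w with
  | zero => simp
  | add x y hx hy => rw [map_add, map_add, hx, hy, add_zero]
  | tmul f w =>
    rw [inclW_tmul, LieModule.toEnd_apply_apply, LieAlgebra.ExtendScalars.bracket_tmul,
      lie_eBracket_eq_zero hS (hV i) hpq w.2, TensorProduct.tmul_zero]

theorem constTorus_le_borel : D.constTorus V T ≤ D.borel V T :=
  Subgroup.closure_mono fun _ ⟨_, ht⟩ => .inl ⟨_, ht⟩

theorem nTilde_le_borel : D.nTilde V ≤ D.borel V T :=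
  Subgroup.closure_mono fun _ ⟨_, _, _, hc, a, hb⟩ =>
    .inr ⟨_, Submodule.tmul_mem_baseChange_of_mem a (D.eBracket_mem_nPlus hc), hb⟩

theorem connection_inclW (i : Fin r) {Z : g₀} {Zi : Module.End ℂ (D.W (V i) i)}
    (hZi : ∀ w, ((Zi w : D.W (V i) i) : V i) = ⁅Z, (w : V i)⁆) (x : RF ⊗[ℂ] D.W (V i) i) :
    connection (V i) (1 ⊗ₜ[ℂ] Z) (D.inclW V i x) =
      D.inclW V i ((RF.dz.toLinearMap.rTensor (D.W (V i) i) + Zi.lTensor RF) x) := by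
  induction x with
  | zero => simp
  | add x y hx hy => simp only [map_add, hx, hy]
  | tmul f w =>
    rw [inclW_tmul, connection_tmul, LinearMap.add_apply, LinearMap.rTensor_tmul,
      LinearMap.lTensor_tmul, map_add, inclW_tmul, inclW_tmul, hZi]
    rfl

/-- The Miura-Plücker condition is inherited by `v b` when `b` lies in the Borel group, preserves
every `W_i(z)` and commutes with `∂_z + Z` there. -/
theorem MiuraPluckerCondition.mul {O : MiuraOper r} {Z : g₀} {v b : Ambient g₀ V}
    (hv : D.MiuraPluckerCondition V T O Z v) (hb : b ∈ D.borel V T)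
    (hbZ : b ∈ D.flatStabilizer V Z) : D.MiuraPluckerCondition V T O Z (v * b) := by
  refine ⟨Subgroup.mul_mem _ hv.1 hb, fun i => ?_⟩
  obtain ⟨vi, Zi, hvi, hZi, h⟩ := hv.2 i
  obtain ⟨bi, hbi⟩ := hbZ i
  have hvs : ∀ w, (v.2.2 i).symm (D.inclW V i w) = D.inclW V i (vi.symm w) := fun w => by
    rw [LinearEquiv.symm_apply_eq, ← hvi, LinearEquiv.apply_symm_apply]
  have hbs : ∀ w, (b.2.2 i).symm (D.inclW V i w) = D.inclW V i (bi.symm w) := fun w => by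
    rw [LinearEquiv.symm_apply_eq, ← (hbi _).1, LinearEquiv.apply_symm_apply]
  have hmul : ∀ y, (v * b).2.2 i y = v.2.2 i (b.2.2 i y) := fun _ => rfl
  have hmuls : ∀ y, ((v * b).2.2 i).symm y = (b.2.2 i).symm ((v.2.2 i).symm y) := fun _ => rfl
  refine ⟨bi.trans vi, Zi, fun w => ?_, hZi, fun w => ⟨?_, ?_⟩⟩
  · rw [LinearEquiv.trans_apply, hvi, (hbi w).1, hmul]
  -- `b⁻¹ v⁻¹ w` lies in `W_i(z)`, so `b` moves past `∂_z + Z` and cancels `b⁻¹`.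
  · rw [(h w).1, hmuls, hmul, hvs, hbs, ← (hbi _).2, ← (hbi _).1, LinearEquiv.apply_symm_apply]
  · rw [hmuls, hmul, hvs, hbs, connection_inclW i hZi, LinearEquiv.trans_apply, hvi, (hbi _).1]
    rfl

/-- `∂_z + Z` maps `W_i(z)` to itself, so `b` fixes both a vector of `W_i(z)` and its image. -/
theorem pointwiseStabilizer_le_flatStabilizer {Z : g₀}
    (hZ : ∀ i, ∃ Zi : Module.End ℂ (D.W (V i) i),
      ∀ w, ((Zi w : D.W (V i) i) : V i) = ⁅Z, (w : V i)⁆) :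
    D.pointwiseStabilizer V ≤ D.flatStabilizer V Z := by
  intro b hb i
  obtain ⟨Zi, hZi⟩ := hZ i
  refine ⟨LinearEquiv.refl _ _, fun w => ⟨(hb i w).symm, ?_⟩⟩
  rw [hb i w, connection_inclW i hZi, hb]

end ChevalleySystem

end LieSuperalgebra

theorem mainTheorem9 {g₀ g₁ : Type*} [LieRing g₀] [LieAlgebra ℂ g₀] [AddCommGroup g₁]
    [Module ℂ g₁] [LieRingModule g₀ g₁] [LieModule ℂ g₀ g₁]
    [FiniteDimensional ℂ g₀] [FiniteDimensional ℂ g₁]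
    (S : LieSuperalgebra g₀ g₁) (hS : S.IsSimple)
    {r : ℕ} (D : S.ChevalleySystem r) (T : D.Torus)
    (V : Fin r → Type*) [∀ i, AddCommGroup (V i)] [∀ i, Module ℂ (V i)]
    [∀ i, LieRingModule g₀ (V i)] [∀ i, LieModule ℂ g₀ (V i)]
    (hV : ∀ i, D.IsIrreducibleHighestWeight (V i) (D.highestWeight i))
    (O : LieSuperalgebra.ChevalleySystem.MiuraOper r)
    (Z : g₀) (hZ : Z ∈ D.cartan)
    (v : LieSuperalgebra.ChevalleySystem.Ambient g₀ V)
    (hv : D.MiuraPluckerCondition V T O Z v) :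
    ∀ g ∈ D.framingCoset V T v, D.MiuraPluckerCondition V T O Z g := by
  rintro _ ⟨h, hh, n, hn, rfl⟩
  -- The condition on `v` already supplies the restriction of `Z` to `W_i`.
  have hZW : ∀ i, ∃ Zi : Module.End ℂ (D.W (V i) i),
      ∀ w, ((Zi w : D.W (V i) i) : V i) = ⁅Z, (w : V i)⁆ := fun i => by
    obtain ⟨_, Zi, _, hZi, _⟩ := hv.2 i
    exact ⟨Zi, hZi⟩
  rw [mul_assoc]
  refine hv.mul T (Subgroup.mul_mem _ ?_ ?_) (Subgroup.mul_mem _ ?_ ?_)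
  · exact LieSuperalgebra.ChevalleySystem.constTorus_le_borel T hh
  · exact LieSuperalgebra.ChevalleySystem.nTilde_le_borel T hn
  · exact LieSuperalgebra.ChevalleySystem.constTorus_le_flatStabilizer T hZ hh
  · exact LieSuperalgebra.ChevalleySystem.pointwiseStabilizer_le_flatStabilizer hZW
      (LieSuperalgebra.ChevalleySystem.nTilde_le_pointwiseStabilizer hS hV hn)
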